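/- Let $L$ be a single-sorted vocabulary (an arbitrary set of relation symbols and function symbols of finite arity, constants being $0$-ary function symbols). The formulas of $L_{\omega_1\omega}$ are built from atomic formulas by negation, countable conjunctions and disjunctions $\bigwedge_n$, $\bigvee_n$, and the quantifiers $\forall x$, $\exists x$ over single variables. Structures have nonempty domains. A formula $\varphi(\bar x)$ of $L_{\omega_1\omega}$ is *preserved by submodels* if for all $L$-structures $N\subseteq M$ ($N$ a substructure of $M$) and all tuples $\bar a$ of elements of $N$, $M\models\varphi(\bar a)$ implies $N\models\varphi(\bar a)$. A formula is *universal* if no variable occurs existentially quantified in it, that is, no existential quantifier occurs in it within the scope of an even number of negations and no universal quantifier within the scope of an odd number of negations. Two formulas are *logically equivalent* if they are satisfied by the same tuples in every $L$-structure. **Theorem (Malitz).** A formula $\varphi(\bar x)$ of $L_{\omega_1\omega}$ is preserved by submodels if and only if it is logically equivalent to a universal formula $\theta(\bar x)$ of $L_{\omega_1\omega}$ in the same vocabulary and the same free variables. -/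

import Mathlib

universe u v u' w

/-- Formulas of the infinitary logic `L_{ω₁ω}` over the (single-sorted) vocabulary `L`, with free
variables named by elements of `α` and `n` further variables indexed by `Fin n` that are available
for quantification (the same de Bruijn convention as Mathlib's `FirstOrder.Language.BoundedFormula`:
a quantifier binds the last of the `n + 1` indexed variables). Conjunctions and disjunctions are
countable; nonempty finite ones arise from sequences with repetitions, and the empty ones are
`¬ ⊥` and `⊥`. -/
inductive InfFormula (L : FirstOrder.Language.{u, v}) (α : Type u') : ℕ → Type (max u v u')
  | falsum {n : ℕ} : InfFormula L α n
  | equal {n : ℕ} (t₁ t₂ : L.Term (α ⊕ Fin n)) : InfFormula L α n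
  | rel {n k : ℕ} (R : L.Relations k) (ts : Fin k → L.Term (α ⊕ Fin n)) : InfFormula L α n
  | not {n : ℕ} (φ : InfFormula L α n) : InfFormula L α n
  | conj {n : ℕ} (φ : ℕ → InfFormula L α n) : InfFormula L α n
  | disj {n : ℕ} (φ : ℕ → InfFormula L α n) : InfFormula L α n
  | all {n : ℕ} (φ : InfFormula L α (n + 1)) : InfFormula L α n
  | ex {n : ℕ} (φ : InfFormula L α (n + 1)) : InfFormula L α n

namespace InfFormula

variable {L : FirstOrder.Language.{u, v}} {α : Type u'}

/-- Tarski satisfaction `M ⊨ φ[x, y]`. -/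
def Realize {M : Type w} [L.Structure M] (x : α → M) :
    ∀ {n : ℕ}, InfFormula L α n → (Fin n → M) → Prop
  | _, falsum, _ => False
  | _, equal t₁ t₂, y => t₁.realize (Sum.elim x y) = t₂.realize (Sum.elim x y)
  | _, rel R ts, y => FirstOrder.Language.Structure.RelMap R fun i => (ts i).realize (Sum.elim x y)
  | _, not φ, y => ¬ Realize x φ y
  | _, conj φ, y => ∀ i, Realize x (φ i) y
  | _, disj φ, y => ∃ i, Realize x (φ i) y
  | _, all φ, y => ∀ a : M, Realize x φ (Fin.snoc y a)
  | _, ex φ, y => ∃ a : M, Realize x φ (Fin.snoc y a)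

mutual

/-- Some variable occurs universally quantified in the formula: a universal quantifier in the
scope of an even number of negations, or an existential one in the scope of an odd number. -/
def HasUniversal : ∀ {n : ℕ}, InfFormula L α n → Prop
  | _, falsum => False
  | _, equal _ _ => False
  | _, rel _ _ => False
  | _, not φ => HasExistential φ
  | _, conj φ => ∃ i, HasUniversal (φ i)
  | _, disj φ => ∃ i, HasUniversal (φ i)
  | _, all _ => True
  | _, ex φ => HasUniversal φ

/-- Some variable occurs existentially quantified in the formula: an existential quantifier in the
scope of an even number of negations, or a universal one in the scope of an odd number. -/
def HasExistential : ∀ {n : ℕ}, InfFormula L α n → Prop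
  | _, falsum => False
  | _, equal _ _ => False
  | _, rel _ _ => False
  | _, not φ => HasUniversal φ
  | _, conj φ => ∃ i, HasExistential (φ i)
  | _, disj φ => ∃ i, HasExistential (φ i)
  | _, all φ => HasExistential φ
  | _, ex _ => True

end

/-- A universal formula: no variable occurs existentially quantified. -/
def IsUniversal {n : ℕ} (φ : InfFormula L α n) : Prop := ¬ HasExistential φ

/-- `M ⊨ φ[x]` for a formula whose free variables are among those named by `α`. -/
def Holds {M : Type w} [L.Structure M] (φ : InfFormula L α 0) (x : α → M) : Prop :=
  Realize x φ Fin.elim0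

/-- `φ` is preserved by submodels: whenever `N` is a (nonempty) substructure of `M`, and `φ` is
true in `M` of elements of `N`, it is true of them in `N`. -/
def PreservedBySubmodels (φ : InfFormula L α 0) : Prop :=
  ∀ (M : Type w) [L.Structure M] (N : L.Substructure M) [Nonempty N] (x : α → N),
    φ.Holds (fun a => (x a : M)) → φ.Holds x

/-- Logical equivalence: the formulas are true of the same elements in every (nonempty)
structure. -/
def LogicallyEquivalent (φ ψ : InfFormula L α 0) : Prop :=
  ∀ (M : Type w) [L.Structure M] [Nonempty M] (x : α → M), φ.Holds x ↔ ψ.Holds x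

end InfFormula

-- A universal formula passes to substructures by induction, together with the dual statement for
-- formulas without universal quantification, because negation exchanges the two.
--
-- The converse is a case of interpolation (`exists_embedding_of_not_interpolated`, used with `ψ =
-- φ`): if no universal formula lies between `φ` and `ψ`, some countable `M` satisfies `φ` at
-- elements of a substructure `N` in which `ψ` fails. This is a Henkin construction, done
-- semantically. A condition is a pair of classes of structures with named elements, the left one
-- describing `M` and the right one `N`, such that no universal formula in the free variables and
-- the names used for `N` holds throughout the left class and fails throughout the right one
-- (`Separable`). The classes of `φ` and of `¬ψ` form a condition by hypothesis. Since universal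
-- formulas are closed under countable conjunction and disjunction and under `∀`, conditions can be
-- extended to choose disjuncts and witnesses on either side. Since quantifier-free formulas are
-- universal along with their negations, conditions can also be extended to make both sides agree on
-- atomic facts about `N` (`Condition.exists_agree`). An ideal of conditions meeting these countably
-- many requirements gives two filters. Truth in their term models is truth along the filter
-- (`realize_termModel`), and reading the terms of `N` in `M` is an embedding.
--
-- Countability costs nothing: a formula uses countably many symbols and variables, and the other
-- symbols can be interpreted trivially (`exists_expansion_embedding`).

section Malitz

open FirstOrder FirstOrder.Language

namespace InfFormula

-- Embeddings, and the easy direction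

section Transport

variable {L : FirstOrder.Language.{u, v}} {α : Type u'}

theorem realize_equiv {M N : Type*} [L.Structure M] [L.Structure N] (e : M ≃[L] N) (x : α → M) :
    ∀ {n : ℕ} (φ : InfFormula L α n) (y : Fin n → M),
      φ.Realize (e ∘ x) (e ∘ y) ↔ φ.Realize x y
  | _, falsum, _ => Iff.rfl
  | _, equal t₁ t₂, y => by
      simp only [Realize, ← Sum.comp_elim, HomClass.realize_term, EmbeddingLike.apply_eq_iff_eq]
  | _, rel R ts, y => by
      simp only [Realize, ← Sum.comp_elim, HomClass.realize_term]
      exact StrongHomClass.map_rel e R _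
  | _, not φ, y => not_congr (realize_equiv e x φ y)
  | _, conj φ, y => forall_congr' fun i => realize_equiv e x (φ i) y
  | _, disj φ, y => exists_congr fun i => realize_equiv e x (φ i) y
  | _, all φ, y => by
      simp only [Realize]
      rw [← e.toEquiv.forall_congr_right]
      exact forall_congr' fun a => by
        rw [← realize_equiv e x φ (Fin.snoc y a), Fin.comp_snoc]; rfl
  | _, ex φ, y => by
      simp only [Realize]
      rw [← e.toEquiv.exists_congr_right]
      exact exists_congr fun a => by
        rw [← realize_equiv e x φ (Fin.snoc y a), Fin.comp_snoc]; rfl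

theorem holds_equiv {M N : Type*} [L.Structure M] [L.Structure N] (e : M ≃[L] N) (x : α → M)
    (φ : InfFormula L α 0) : φ.Holds (e ∘ x) ↔ φ.Holds x := by
  rw [Holds, Holds, ← realize_equiv e x φ Fin.elim0]
  exact iff_of_eq (congrArg _ (Subsingleton.elim _ _))

/-- Along an embedding, formulas without existential quantification are reflected, and formulas
without universal quantification are preserved. -/
theorem realize_embedding {M N : Type*} [L.Structure M] [L.Structure N] (f : N ↪[L] M)
    (x : α → N) : ∀ {n : ℕ} (φ : InfFormula L α n) (y : Fin n → N),
      (¬ φ.HasExistential → φ.Realize (f ∘ x) (f ∘ y) → φ.Realize x y) ∧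
      (¬ φ.HasUniversal → φ.Realize x y → φ.Realize (f ∘ x) (f ∘ y))
  | _, falsum, _ => ⟨fun _ h => h, fun _ h => h⟩
  | _, equal t₁ t₂, y => by
      simp [Realize, ← Sum.comp_elim, HomClass.realize_term]
  | _, rel R ts, y => by
      have h : (rel R ts).Realize (f ∘ x) (f ∘ y) ↔ (rel R ts).Realize x y := by
        simp only [Realize, ← Sum.comp_elim, HomClass.realize_term]
        exact StrongHomClass.map_rel f R _
      exact ⟨fun _ => h.1, fun _ => h.2⟩
  | _, not φ, y => by
      have ih := realize_embedding f x φ y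
      simp only [HasExistential, HasUniversal, Realize]
      exact ⟨fun h => mt (ih.2 h), fun h => mt (ih.1 h)⟩
  | _, conj φ, y => by
      have ih := fun i => realize_embedding f x (φ i) y
      simp only [HasExistential, HasUniversal, Realize, not_exists]
      exact ⟨fun h H i => (ih i).1 (h i) (H i), fun h H i => (ih i).2 (h i) (H i)⟩
  | _, disj φ, y => by
      have ih := fun i => realize_embedding f x (φ i) y
      simp only [HasExistential, HasUniversal, Realize, not_exists]
      exact ⟨fun h ⟨i, H⟩ => ⟨i, (ih i).1 (h i) H⟩, fun h ⟨i, H⟩ => ⟨i, (ih i).2 (h i) H⟩⟩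
  | _, all φ, y => by
      have ih := fun a => realize_embedding f x φ (Fin.snoc y a)
      simp only [HasExistential, HasUniversal, Realize, not_true_eq_false, false_imp_iff, and_true]
      refine fun h H a => (ih a).1 h ?_
      rw [Fin.comp_snoc]
      exact H _
  | _, ex φ, y => by
      have ih := fun a => realize_embedding f x φ (Fin.snoc y a)
      simp only [HasExistential, HasUniversal, Realize, not_true_eq_false, false_imp_iff, true_and]
      rintro h ⟨a, H⟩
      refine ⟨f a, ?_⟩
      rw [← Fin.comp_snoc]
      exact (ih a).2 h H

theorem IsUniversal.holds_of_embedding {M N : Type*} [L.Structure M] [L.Structure N]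
    {φ : InfFormula L α 0} (hφ : φ.IsUniversal) (f : N ↪[L] M) (x : α → N)
    (h : φ.Holds (f ∘ x)) : φ.Holds x := by
  refine (realize_embedding f x φ Fin.elim0).1 hφ ?_
  rw [Subsingleton.elim (f ∘ Fin.elim0) Fin.elim0]
  exact h

theorem IsUniversal.preservedBySubmodels {φ : InfFormula L α 0} (hφ : φ.IsUniversal) :
    PreservedBySubmodels.{u, v, u', w} φ :=
  fun _ _ N _ x h => hφ.holds_of_embedding N.subtype x h

theorem PreservedBySubmodels.congr {φ ψ : InfFormula L α 0}
    (hφ : PreservedBySubmodels.{u, v, u', w} φ) (h : LogicallyEquivalent.{u, v, u', w} φ ψ) :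
    PreservedBySubmodels.{u, v, u', w} ψ := fun M _ N hN x hx => by
  have : Nonempty M := hN.map Subtype.val
  exact (h N x).1 (hφ M N x ((h M _).2 hx))

/-- Preservation by submodels extends to embeddings of countable structures in any universe. -/
theorem PreservedBySubmodels.holds_of_embedding {M N : Type*} [L.Structure M] [L.Structure N]
    [Countable M] [Nonempty N] {φ : InfFormula L α 0}
    (hφ : PreservedBySubmodels.{u, v, u', w} φ) (f : N ↪[L] M) (x : α → N)
    (h : φ.Holds (f ∘ x)) : φ.Holds x := by
  -- A countable type is small in every universe, so `M` has a copy in `Type w`, where the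
  -- hypothesis applies to the image of `N`.
  let : L.Structure (Shrink.{w} M) := Equiv.inducedStructure (equivShrink.{w} M)
  let e : M ≃[L] Shrink.{w} M := Equiv.inducedStructureEquiv (equivShrink.{w} M)
  let g : N ↪[L] Shrink.{w} M := e.toEmbedding.comp f
  have : Nonempty g.toHom.range := ‹Nonempty N›.map g.equivRange
  rw [← holds_equiv g.equivRange x]
  refine hφ _ g.toHom.range (g.equivRange ∘ x) ?_
  exact (holds_equiv e (f ∘ x) φ).2 h

end Transport

-- Change of vocabulary and variables

section Map

variable {L : FirstOrder.Language.{u, v}} {α : Type u'} {L' : FirstOrder.Language} {β : Type*}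

/-- Change of vocabulary and of free variables. -/
def map (g : L' →ᴸ L) (h : β → α) : ∀ {n : ℕ}, InfFormula L' β n → InfFormula L α n
  | _, falsum => falsum
  | _, equal t₁ t₂ =>
      equal (g.onTerm (t₁.relabel (Sum.map h id))) (g.onTerm (t₂.relabel (Sum.map h id)))
  | _, rel R ts => rel (g.onRelation R) fun i => g.onTerm ((ts i).relabel (Sum.map h id))
  | _, not φ => not (map g h φ)
  | _, conj φ => conj fun i => map g h (φ i)
  | _, disj φ => disj fun i => map g h (φ i)
  | _, all φ => all (map g h φ)
  | _, ex φ => ex (map g h φ)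

theorem realize_map (g : L' →ᴸ L) (h : β → α) {M : Type*} [L'.Structure M] [L.Structure M]
    [g.IsExpansionOn M] (x : α → M) : ∀ {n : ℕ} (φ : InfFormula L' β n) (y : Fin n → M),
      (φ.map g h).Realize x y ↔ φ.Realize (x ∘ h) y
  | _, falsum, _ => Iff.rfl
  | _, equal t₁ t₂, y => by
      simp [map, Realize, LHom.realize_onTerm, Term.realize_relabel, Sum.elim_comp_map]
  | _, rel R ts, y => by
      simp [map, Realize, LHom.realize_onTerm, Term.realize_relabel, Sum.elim_comp_map]
  | _, not φ, y => not_congr (realize_map g h x φ y)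
  | _, conj φ, y => forall_congr' fun i => realize_map g h x (φ i) y
  | _, disj φ, y => exists_congr fun i => realize_map g h x (φ i) y
  | _, all φ, y => forall_congr' fun a => realize_map g h x φ (Fin.snoc y a)
  | _, ex φ, y => exists_congr fun a => realize_map g h x φ (Fin.snoc y a)

theorem holds_map (g : L' →ᴸ L) (h : β → α) {M : Type*} [L'.Structure M] [L.Structure M]
    [g.IsExpansionOn M] (x : α → M) (φ : InfFormula L' β 0) :
    (φ.map g h).Holds x ↔ φ.Holds (x ∘ h) :=
  realize_map g h x φ _

theorem hasQuantifier_map (g : L' →ᴸ L) (h : β → α) : ∀ {n : ℕ} (φ : InfFormula L' β n),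
    ((φ.map g h).HasExistential ↔ φ.HasExistential) ∧
      ((φ.map g h).HasUniversal ↔ φ.HasUniversal)
  | _, falsum => ⟨Iff.rfl, Iff.rfl⟩
  | _, equal _ _ => ⟨Iff.rfl, Iff.rfl⟩
  | _, rel _ _ => ⟨Iff.rfl, Iff.rfl⟩
  | _, not φ => by
      simp only [map, HasExistential, HasUniversal]
      exact (hasQuantifier_map g h φ).symm
  | _, conj φ => by
      simp only [map, HasExistential, HasUniversal]
      exact ⟨exists_congr fun i => (hasQuantifier_map g h (φ i)).1,
        exists_congr fun i => (hasQuantifier_map g h (φ i)).2⟩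
  | _, disj φ => by
      simp only [map, HasExistential, HasUniversal]
      exact ⟨exists_congr fun i => (hasQuantifier_map g h (φ i)).1,
        exists_congr fun i => (hasQuantifier_map g h (φ i)).2⟩
  | _, all φ => by
      simp only [map, HasExistential, HasUniversal]
      exact ⟨(hasQuantifier_map g h φ).1, trivial⟩
  | _, ex φ => by
      simp only [map, HasExistential, HasUniversal]
      exact ⟨trivial, (hasQuantifier_map g h φ).2⟩

theorem IsUniversal.map {n : ℕ} {φ : InfFormula L' β n} (hφ : φ.IsUniversal) (g : L' →ᴸ L)
    (h : β → α) : (φ.map g h).IsUniversal :=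
  mt (hasQuantifier_map g h φ).1.1 hφ

end Map

-- Reduction to countable vocabularies

section Sublanguage

variable {L : FirstOrder.Language.{u, v}} {α : Type u'}

/-- The language with the given function and relation symbols of `L`. -/
def sublanguage (F : Set (Σ n, L.Functions n)) (R : Set (Σ n, L.Relations n)) :
    FirstOrder.Language.{u, v} where
  Functions n := {f : L.Functions n // ⟨n, f⟩ ∈ F}
  Relations n := {r : L.Relations n // ⟨n, r⟩ ∈ R}

/-- The inclusion of a sublanguage. -/
def sublanguageHom (F : Set (Σ n, L.Functions n)) (R : Set (Σ n, L.Relations n)) :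
    sublanguage F R →ᴸ L where
  onFunction := fun _ f => f.1
  onRelation := fun _ r => r.1

theorem sublanguageHom_injective (F : Set (Σ n, L.Functions n)) (R : Set (Σ n, L.Relations n)) :
    (sublanguageHom F R).Injective :=
  ⟨fun h => Subtype.ext h, fun h => Subtype.ext h⟩

instance {F : Set (Σ n, L.Functions n)} [Countable F] {R : Set (Σ n, L.Relations n)} :
    Countable (Σ n, (sublanguage F R).Functions n) :=
  Function.Injective.countable (β := F) (f := fun f => ⟨⟨f.1, f.2.1⟩, f.2.2⟩) <| by
    rintro ⟨n, f, hf⟩ ⟨m, g, hg⟩ h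
    simp only [Subtype.mk.injEq, Sigma.mk.injEq] at h
    obtain ⟨rfl, h⟩ := h
    cases h
    rfl

instance {F : Set (Σ n, L.Functions n)} {R : Set (Σ n, L.Relations n)} [Countable R] :
    Countable (Σ n, (sublanguage F R).Relations n) :=
  Function.Injective.countable (β := R) (f := fun f => ⟨⟨f.1, f.2.1⟩, f.2.2⟩) <| by
    rintro ⟨n, f, hf⟩ ⟨m, g, hg⟩ h
    simp only [Subtype.mk.injEq, Sigma.mk.injEq] at h
    obtain ⟨rfl, h⟩ := h
    cases h
    rfl

/-- Allowing all larger `F` and `A` lets the constituents of a compound expression be rebuilt in one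
common sublanguage. -/
theorem exists_sublanguage_term {n : ℕ} (t : L.Term (α ⊕ Fin n)) :
    ∃ (F₀ : Set (Σ n, L.Functions n)) (A₀ : Set α), F₀.Countable ∧ A₀.Countable ∧
      ∀ F R A, F₀ ⊆ F → A₀ ⊆ A → ∃ t' : (sublanguage F R).Term (A ⊕ Fin n),
        (sublanguageHom F R).onTerm (t'.relabel (Sum.map Subtype.val id)) = t := by
  induction t with
  | var a =>
    rcases a with a | i
    · exact ⟨∅, {a}, Set.countable_empty, Set.countable_singleton a, fun F R A _ hA =>
        ⟨Term.var (Sum.inl ⟨a, hA rfl⟩), rfl⟩⟩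
    · exact ⟨∅, ∅, Set.countable_empty, Set.countable_empty, fun F R A _ hA =>
        ⟨Term.var (Sum.inr i), rfl⟩⟩
  | @func l f ts ih =>
    choose F₀ A₀ hF hA h using ih
    refine ⟨insert ⟨l, f⟩ (⋃ i, F₀ i), ⋃ i, A₀ i, (Set.countable_iUnion hF).insert _,
      Set.countable_iUnion hA, fun F R A hF' hA' => ?_⟩
    rw [Set.insert_subset_iff, Set.iUnion_subset_iff] at hF'
    rw [Set.iUnion_subset_iff] at hA'
    choose ts' hts' using fun i => h i F R A (hF'.2 i) (hA' i)
    refine ⟨Term.func (⟨f, hF'.1⟩ : (sublanguage F R).Functions l) ts', ?_⟩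
    simp only [Term.relabel, LHom.onTerm, hts']
    rfl

/-- Every formula comes from a countable sublanguage and countably many variables. -/
theorem exists_sublanguage {n : ℕ} (φ : InfFormula L α n) :
    ∃ (F₀ : Set (Σ n, L.Functions n)) (R₀ : Set (Σ n, L.Relations n)) (A₀ : Set α),
      F₀.Countable ∧ R₀.Countable ∧ A₀.Countable ∧
      ∀ F R A, F₀ ⊆ F → R₀ ⊆ R → A₀ ⊆ A →
        ∃ φ' : InfFormula (sublanguage F R) A n,
          φ'.map (sublanguageHom F R) Subtype.val = φ := by
  induction φ with
  | falsum => exact ⟨∅, ∅, ∅, by simp, by simp, by simp, fun _ _ _ _ _ _ => ⟨falsum, rfl⟩⟩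
  | equal t₁ t₂ =>
    obtain ⟨F₁, A₁, hF₁, hA₁, h₁⟩ := exists_sublanguage_term t₁
    obtain ⟨F₂, A₂, hF₂, hA₂, h₂⟩ := exists_sublanguage_term t₂
    refine ⟨F₁ ∪ F₂, ∅, A₁ ∪ A₂, hF₁.union hF₂, Set.countable_empty, hA₁.union hA₂,
      fun F R A hF _ hA => ?_⟩
    rw [Set.union_subset_iff] at hF hA
    obtain ⟨t₁', rfl⟩ := h₁ F R A hF.1 hA.1
    obtain ⟨t₂', rfl⟩ := h₂ F R A hF.2 hA.2
    exact ⟨equal t₁' t₂', rfl⟩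
  | @rel n k r ts =>
    choose F₀ A₀ hF hA h using fun i => exists_sublanguage_term (ts i)
    refine ⟨⋃ i, F₀ i, {⟨k, r⟩}, ⋃ i, A₀ i, Set.countable_iUnion hF, Set.countable_singleton _,
      Set.countable_iUnion hA, fun F R A hF' hR hA' => ?_⟩
    rw [Set.iUnion_subset_iff] at hF' hA'
    choose ts' hts' using fun i => h i F R A (hF' i) (hA' i)
    refine ⟨rel (⟨r, hR rfl⟩ : (sublanguage F R).Relations k) ts', ?_⟩
    simp only [map, hts']
    rfl
  | not φ ih =>
    obtain ⟨F₀, R₀, A₀, hF, hR, hA, h⟩ := ih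
    refine ⟨F₀, R₀, A₀, hF, hR, hA, fun F R A hF hR hA => ?_⟩
    obtain ⟨φ', rfl⟩ := h F R A hF hR hA
    exact ⟨not φ', rfl⟩
  | conj φ ih =>
    choose F₀ R₀ A₀ hF hR hA h using ih
    refine ⟨⋃ i, F₀ i, ⋃ i, R₀ i, ⋃ i, A₀ i, Set.countable_iUnion hF, Set.countable_iUnion hR,
      Set.countable_iUnion hA, fun F R A hF' hR' hA' => ?_⟩
    rw [Set.iUnion_subset_iff] at hF' hR' hA'
    choose φ' hφ' using fun i => h i F R A (hF' i) (hR' i) (hA' i)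
    exact ⟨conj φ', by simp only [map, hφ']⟩
  | disj φ ih =>
    choose F₀ R₀ A₀ hF hR hA h using ih
    refine ⟨⋃ i, F₀ i, ⋃ i, R₀ i, ⋃ i, A₀ i, Set.countable_iUnion hF, Set.countable_iUnion hR,
      Set.countable_iUnion hA, fun F R A hF' hR' hA' => ?_⟩
    rw [Set.iUnion_subset_iff] at hF' hR' hA'
    choose φ' hφ' using fun i => h i F R A (hF' i) (hR' i) (hA' i)
    exact ⟨disj φ', by simp only [map, hφ']⟩
  | all φ ih =>
    obtain ⟨F₀, R₀, A₀, hF, hR, hA, h⟩ := ih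
    refine ⟨F₀, R₀, A₀, hF, hR, hA, fun F R A hF hR hA => ?_⟩
    obtain ⟨φ', rfl⟩ := h F R A hF hR hA
    exact ⟨all φ', rfl⟩
  | ex φ ih =>
    obtain ⟨F₀, R₀, A₀, hF, hR, hA, h⟩ := ih
    refine ⟨F₀, R₀, A₀, hF, hR, hA, fun F R A hF hR hA => ?_⟩
    obtain ⟨φ', rfl⟩ := h F R A hF hR hA
    exact ⟨ex φ', rfl⟩

/-- Default expansions turn embeddings into embeddings. -/
theorem exists_expansion_embedding {L' : FirstOrder.Language} {g : L' →ᴸ L} (hg : g.Injective)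
    {M N : Type*} [L'.Structure M] [L'.Structure N] [Nonempty N] (f : N ↪[L'] M) :
    ∃ (_ : L.Structure M) (_ : L.Structure N) (_ : g.IsExpansionOn M) (_ : g.IsExpansionOn N)
      (f' : N ↪[L] M), ⇑f' = f := by
  classical
  let iN : Inhabited N := Classical.inhabited_of_nonempty ‹_›
  -- The default of `M` is the image of the default of `N`, so `f` commutes with the added function
  -- symbols, which are constantly the default.
  let iM : Inhabited M := ⟨f default⟩
  let sM := g.defaultExpansion M
  let sN := g.defaultExpansion N
  refine ⟨sM, sN, hg.isExpansionOn_default M, hg.isExpansionOn_default N,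
    { toEmbedding := f.toEmbedding, map_fun' := ?_, map_rel' := ?_ }, rfl⟩
  · intro n h x
    by_cases hh : h ∈ Set.range fun k : L'.Functions n => g.onFunction k
    · exact (congrArg f (dif_pos hh)).trans ((f.map_fun _ _).trans (by symm; exact dif_pos hh))
    · exact (congrArg f (dif_neg hh)).trans (by symm; exact dif_neg hh)
  · intro n r x
    by_cases hr : r ∈ Set.range fun k : L'.Relations n => g.onRelation k
    · exact (iff_of_eq (dif_pos hr)).trans ((f.map_rel _ _).trans (by symm; exact iff_of_eq (dif_pos hr)))
    · exact (iff_of_eq (dif_neg hr)).trans (by symm; exact iff_of_eq (dif_neg hr))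

end Sublanguage

end InfFormula

-- Term models of filters

/-- A structure together with an interpretation of the variables in `V`. -/
structure PointedStructure (L : FirstOrder.Language.{u, v}) (V : Type u') where
  /-- The underlying type. -/
  carrier : Type w
  [str : L.Structure carrier]
  /-- The interpretation of the variables. -/
  val : V → carrier

attribute [instance] PointedStructure.str

section TermModel

variable {L : FirstOrder.Language.{u, v}} {V : Type u'}

/-- Two terms are equivalent if they are eventually equal along the filter. -/
def Filter.termSetoid (H : Filter (PointedStructure.{u, v, u', w} L V)) : Setoid (L.Term V) where
  r s t := ∀ᶠ ω in H, s.realize ω.val = t.realize ω.val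
  iseqv :=
    { refl := fun _ => Filter.Eventually.of_forall fun _ => rfl
      symm := fun h => h.mono fun _ => Eq.symm
      trans := fun h₁ h₂ => by filter_upwards [h₁, h₂] with ω a b using a.trans b }

/-- The terms, with the eventually true relations, before dividing by eventual equality. -/
instance Filter.termPrestructure (H : Filter (PointedStructure.{u, v, u', w} L V)) :
    L.Prestructure H.termSetoid where
  toStructure :=
    { funMap := fun f ts => Term.func f ts
      RelMap := fun R ts => ∀ᶠ ω in H, Structure.RelMap R fun i => (ts i).realize ω.val }
  fun_equiv x y h :=
    -- Arities are finite, so the eventual equalities of the arguments hold simultaneously.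
    (Filter.eventually_all.2 h).mono fun _ h => congrArg (Structure.funMap _) (funext h)
  rel_equiv {n} r x y h := by
    have h' := Filter.eventually_all.2 h
    refine propext ⟨fun H => (H.and h').mono fun ω hω => ?_,
      fun H => (H.and h').mono fun ω hω => ?_⟩
    · rw [← funext hω.2]; exact hω.1
    · rw [funext hω.2]; exact hω.1

variable (H : Filter (PointedStructure.{u, v, u', w} L V))

theorem Filter.realize_termModel {β : Type*} (t : L.Term β) (ρ : β → L.Term V) :
    (t.realize fun b => (Quotient.mk H.termSetoid (ρ b))) = Quotient.mk H.termSetoid (t.subst ρ) := by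
  rw [Term.realize_quotient_mk' H.termSetoid]
  congr 1
  induction t with
  | var => rfl
  | func f ts ih => exact congrArg (Term.func f) (funext ih)

end TermModel

-- The truth lemma

namespace InfFormula

variable {L : FirstOrder.Language.{u, v}} {α : Type u'} {B : Type}

/-- The pointed structures that satisfy `φ`, its indexed variables being replaced by terms. -/
def sat {n : ℕ} (φ : InfFormula L α n) (ρ : Fin n → L.Term (α ⊕ B)) :
    Set (PointedStructure.{u, v, u', w} L (α ⊕ B)) :=
  {ω | φ.Realize (fun a => ω.val (Sum.inl a)) fun i => (ρ i).realize ω.val}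

/-- `S` contains enough information to decide `φ` in terms of its immediate constituents. -/
def Decides (S : Set (PointedStructure.{u, v, u', w} L (α ⊕ B))) :
    ∀ {n : ℕ}, InfFormula L α n → (Fin n → L.Term (α ⊕ B)) → Prop
  -- Atomic formulas need no decision, because the term model interprets them by eventual truth.
  | _, falsum, _ => True
  | _, equal _ _, _ => True
  | _, rel _ _, _ => True
  | _, not φ, ρ => S ⊆ sat φ ρ ∨ S ⊆ (sat φ ρ)ᶜ
  | _, conj φ, ρ => S ⊆ sat (conj φ) ρ ∨ ∃ i, S ⊆ (sat (φ i) ρ)ᶜ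
  | _, disj φ, ρ => S ⊆ (sat (disj φ) ρ)ᶜ ∨ ∃ i, S ⊆ sat (φ i) ρ
  | _, all φ, ρ => S ⊆ sat (all φ) ρ ∨ ∃ t, S ⊆ (sat φ (Fin.snoc ρ t : Fin (_ + 1) → _))ᶜ
  | _, ex φ, ρ => S ⊆ (sat (ex φ) ρ)ᶜ ∨ ∃ t, S ⊆ sat φ (Fin.snoc ρ t : Fin (_ + 1) → _)

/-- The subformulas of a formula. -/
def subformulas : ∀ {n : ℕ}, InfFormula L α n → Set (Σ n, InfFormula L α n)
  | n, falsum => {⟨n, falsum⟩}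
  | _, equal t₁ t₂ => {⟨_, equal t₁ t₂⟩}
  | _, rel R ts => {⟨_, rel R ts⟩}
  | _, not φ => insert ⟨_, not φ⟩ (subformulas φ)
  | _, conj φ => insert ⟨_, conj φ⟩ (⋃ i, subformulas (φ i))
  | _, disj φ => insert ⟨_, disj φ⟩ (⋃ i, subformulas (φ i))
  | _, all φ => insert ⟨_, all φ⟩ (subformulas φ)
  | _, ex φ => insert ⟨_, ex φ⟩ (subformulas φ)

theorem countable_subformulas {n : ℕ} (φ : InfFormula L α n) : φ.subformulas.Countable := by
  induction φ with
  | falsum => exact Set.countable_singleton _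
  | equal => exact Set.countable_singleton _
  | rel => exact Set.countable_singleton _
  | not φ ih => exact ih.insert _
  | conj φ ih => exact (Set.countable_iUnion ih).insert _
  | disj φ ih => exact (Set.countable_iUnion ih).insert _
  | all φ ih => exact ih.insert _
  | ex φ ih => exact ih.insert _

theorem realize_term_snoc {n : ℕ} (ω : PointedStructure.{u, v, u', w} L (α ⊕ B))
    (ρ : Fin n → L.Term (α ⊕ B)) (t : L.Term (α ⊕ B)) :
    (fun i => ((Fin.snoc ρ t : Fin (n + 1) → L.Term (α ⊕ B)) i).realize ω.val) =
      Fin.snoc (fun i => (ρ i).realize ω.val) (t.realize ω.val) :=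
  Fin.comp_snoc (fun t : L.Term (α ⊕ B) => t.realize ω.val) ρ t

theorem sat_all_subset {n : ℕ} (φ : InfFormula L α (n + 1)) (ρ : Fin n → L.Term (α ⊕ B))
    (t : L.Term (α ⊕ B)) :
    (sat (all φ) ρ : Set (PointedStructure.{u, v, u', w} L (α ⊕ B))) ⊆
      sat φ (Fin.snoc ρ t : Fin (n + 1) → _) := fun ω h => by
  rw [sat, Set.mem_ofPred_eq, realize_term_snoc]
  exact h _

theorem sat_subset_ex {n : ℕ} (φ : InfFormula L α (n + 1)) (ρ : Fin n → L.Term (α ⊕ B))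
    (t : L.Term (α ⊕ B)) :
    sat φ (Fin.snoc ρ t : Fin (n + 1) → _) ⊆
      (sat (ex φ) ρ : Set (PointedStructure.{u, v, u', w} L (α ⊕ B))) := fun ω h => by
  rw [sat, Set.mem_ofPred_eq, realize_term_snoc] at h
  exact ⟨_, h⟩

theorem realize_subst_elim {n : ℕ} (t : L.Term (α ⊕ Fin n)) (ρ : Fin n → L.Term (α ⊕ B))
    (ω : PointedStructure.{u, v, u', w} L (α ⊕ B)) :
    (t.subst (Sum.elim (fun a => Term.var (Sum.inl a)) ρ)).realize ω.val =
      t.realize (Sum.elim (fun a => ω.val (Sum.inl a)) fun i => (ρ i).realize ω.val) := by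
  rw [Term.realize_subst]
  congr 1
  ext (a | i) <;> rfl

/-- The truth lemma: if all subformulas of `φ` are decided, truth in the term model is truth
along the filter. -/
theorem realize_termModel (H : Filter (PointedStructure.{u, v, u', w} L (α ⊕ B))) [H.NeBot]
    {n : ℕ} (φ : InfFormula L α n) :
    (∀ χ ∈ φ.subformulas, ∀ ρ : Fin χ.1 → L.Term (α ⊕ B), ∃ S ∈ H, Decides S χ.2 ρ) →
    ∀ ρ : Fin n → L.Term (α ⊕ B),
      φ.Realize (fun a => Quotient.mk H.termSetoid (Term.var (Sum.inl a)))
        (fun i => Quotient.mk H.termSetoid (ρ i)) ↔ sat φ ρ ∈ H := by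
  -- The filter is proper but need not be an ultrafilter; the missing half is supplied by `Decides`,
  -- one subformula at a time.
  have contra : ∀ {A : Set (PointedStructure.{u, v, u', w} L (α ⊕ B))}, A ∈ H → Aᶜ ∉ H :=
    fun hA hA' => Filter.empty_notMem H (by simpa using Filter.inter_mem hA hA')
  have elim : ∀ {n : ℕ} (ρ : Fin n → L.Term (α ⊕ B)),
      (Sum.elim (fun a => Quotient.mk H.termSetoid (Term.var (Sum.inl a)))
        fun i => Quotient.mk H.termSetoid (ρ i)) =
      fun b => Quotient.mk H.termSetoid (Sum.elim (fun a => Term.var (Sum.inl a)) ρ b) := by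
    intro n ρ
    ext (a | i) <;> rfl
  induction φ with
  | falsum => exact fun _ ρ => ⟨False.elim, fun h => Filter.empty_notMem H h⟩
  | equal t₁ t₂ =>
    intro _ ρ
    rw [Realize, elim, Filter.realize_termModel, Filter.realize_termModel, Quotient.eq]
    refine iff_of_eq (congrArg (· ∈ H) ?_)
    ext ω
    simp only [Set.mem_ofPred_eq, sat, Realize, realize_subst_elim]
  | rel R ts =>
    intro _ ρ
    rw [Realize, elim]
    simp only [Filter.realize_termModel]
    rw [relMap_quotient_mk']
    refine iff_of_eq (congrArg (· ∈ H) ?_)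
    ext ω
    simp only [Set.mem_ofPred_eq, sat, Realize, realize_subst_elim]
  | not φ ih =>
    intro h ρ
    obtain ⟨S, hS, hd⟩ := h ⟨_, not φ⟩ (Set.mem_insert _ _) ρ
    refine (not_congr (ih (fun χ hχ => h χ (Set.mem_insert_of_mem _ hχ)) ρ)).trans
      ⟨fun hn => ?_, fun hm hp => contra hp hm⟩
    rcases hd with hd | hd
    · exact absurd (Filter.mem_of_superset hS hd) hn
    · exact Filter.mem_of_superset hS hd
  | conj φ ih =>
    intro h ρ
    obtain ⟨S, hS, hd⟩ := h ⟨_, conj φ⟩ (Set.mem_insert _ _) ρ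
    refine (forall_congr' fun i => ih i (fun χ hχ => h χ (Set.mem_insert_of_mem _
      (Set.mem_iUnion_of_mem i hχ))) ρ).trans
      ⟨fun hn => ?_, fun hm i => Filter.mem_of_superset hm fun ω hω => hω i⟩
    rcases hd with hd | ⟨i, hd⟩
    · exact Filter.mem_of_superset hS hd
    · exact absurd (Filter.mem_of_superset hS hd) (contra (hn i))
  | disj φ ih =>
    intro h ρ
    obtain ⟨S, hS, hd⟩ := h ⟨_, disj φ⟩ (Set.mem_insert _ _) ρ
    refine (exists_congr fun i => ih i (fun χ hχ => h χ (Set.mem_insert_of_mem _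
      (Set.mem_iUnion_of_mem i hχ))) ρ).trans
      ⟨fun ⟨i, hi⟩ => Filter.mem_of_superset hi fun ω hω => ⟨i, hω⟩, fun hm => ?_⟩
    rcases hd with hd | ⟨i, hd⟩
    · exact absurd (Filter.mem_of_superset hS hd) (contra hm)
    · exact ⟨i, Filter.mem_of_superset hS hd⟩
  | all φ ih =>
    intro h ρ
    obtain ⟨S, hS, hd⟩ := h ⟨_, all φ⟩ (Set.mem_insert _ _) ρ
    have ih' := fun t => ih (fun χ hχ => h χ (Set.mem_insert_of_mem _ hχ))
      (Fin.snoc ρ t : Fin (_ + 1) → _)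
    simp only [Realize, Quotient.forall]
    refine (forall_congr' fun t => ?_).trans (b := ∀ t, sat φ (Fin.snoc ρ t : Fin (_ + 1) → _) ∈ H)
      ⟨fun hn => ?_, fun hm t => Filter.mem_of_superset hm (sat_all_subset φ ρ t)⟩
    · rw [← ih' t]
      exact iff_of_eq (congrArg _ (Fin.comp_snoc (Quotient.mk H.termSetoid) ρ t).symm)
    · rcases hd with hd | ⟨t, hd⟩
      · exact Filter.mem_of_superset hS hd
      · exact absurd (Filter.mem_of_superset hS hd) (contra (hn t))
  | ex φ ih =>
    intro h ρ
    obtain ⟨S, hS, hd⟩ := h ⟨_, ex φ⟩ (Set.mem_insert _ _) ρ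
    have ih' := fun t => ih (fun χ hχ => h χ (Set.mem_insert_of_mem _ hχ))
      (Fin.snoc ρ t : Fin (_ + 1) → _)
    simp only [Realize, Quotient.exists]
    refine (exists_congr fun t => ?_).trans (b := ∃ t, sat φ (Fin.snoc ρ t : Fin (_ + 1) → _) ∈ H)
      ⟨fun ⟨t, ht⟩ => Filter.mem_of_superset ht (sat_subset_ex φ ρ t), fun hm => ?_⟩
    · rw [← ih' t]
      exact iff_of_eq (congrArg _ (Fin.comp_snoc (Quotient.mk H.termSetoid) ρ t).symm)
    · rcases hd with hd | ⟨t, hd⟩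
      · exact absurd (Filter.mem_of_superset hS hd) (contra hm)
      · exact ⟨t, Filter.mem_of_superset hS hd⟩

-- Generic ideals and their filters

section Decide

variable {P : Type*} [Preorder P] {S : P → Set (PointedStructure.{u, v, u', w} L (α ⊕ B))}

/-- If the members of a poset of conditions can be extended to choose members of countable
disjunctions and to find witnesses, they can be extended to decide any formula. -/
theorem exists_decides
    (hdisj : ∀ p {n : ℕ} (φ : ℕ → InfFormula L α n) (ρ : Fin n → L.Term (α ⊕ B)),
      S p ⊆ sat (disj φ) ρ → ∃ q, p ≤ q ∧ ∃ i, S q ⊆ sat (φ i) ρ)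
    (hex : ∀ p {n : ℕ} (φ : InfFormula L α (n + 1)) (ρ : Fin n → L.Term (α ⊕ B)),
      S p ⊆ sat (ex φ) ρ → ∃ q, p ≤ q ∧ ∃ t, S q ⊆ sat φ (Fin.snoc ρ t : Fin (n + 1) → _))
    (p : P) {n : ℕ} (χ : InfFormula L α n) (ρ : Fin n → L.Term (α ⊕ B)) :
    ∃ q, p ≤ q ∧ Decides (S q) χ ρ := by
  have hdec : ∀ p {n : ℕ} (φ : InfFormula L α n) (ρ : Fin n → L.Term (α ⊕ B)),
      ∃ q, p ≤ q ∧ (S q ⊆ sat φ ρ ∨ S q ⊆ (sat φ ρ)ᶜ) := by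
    intro p n φ ρ
    -- Choosing a member of the valid disjunction of `φ, ¬φ, ¬φ, …` decides `φ`.
    obtain ⟨q, hq, i, hi⟩ := hdisj p (fun i => if i = 0 then φ else not φ) ρ fun ω _ => by
      by_cases h : ω ∈ sat φ ρ
      · exact ⟨0, h⟩
      · exact ⟨1, h⟩
    refine ⟨q, hq, ?_⟩
    rcases i with _ | i
    · exact Or.inl (by simpa using hi)
    · exact Or.inr hi
  cases χ with
  | falsum => exact ⟨p, le_rfl, trivial⟩
  | equal => exact ⟨p, le_rfl, trivial⟩
  | rel => exact ⟨p, le_rfl, trivial⟩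
  | not φ => exact hdec p φ ρ
  | conj φ =>
    obtain ⟨q, hq, h | h⟩ := hdec p (conj φ) ρ
    · exact ⟨q, hq, Or.inl h⟩
    · obtain ⟨r, hr, i, hi⟩ := hdisj q (fun i => not (φ i)) ρ fun ω hω =>
        Classical.not_forall.1 (h hω)
      exact ⟨r, hq.trans hr, Or.inr ⟨i, hi⟩⟩
  | disj φ =>
    obtain ⟨q, hq, h | h⟩ := hdec p (disj φ) ρ
    · obtain ⟨r, hr, i, hi⟩ := hdisj q φ ρ h
      exact ⟨r, hq.trans hr, Or.inr ⟨i, hi⟩⟩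
    · exact ⟨q, hq, Or.inl h⟩
  | all φ =>
    obtain ⟨q, hq, h | h⟩ := hdec p (all φ) ρ
    · exact ⟨q, hq, Or.inl h⟩
    · obtain ⟨r, hr, t, ht⟩ := hex q (not φ) ρ fun ω hω => Classical.not_forall.1 (h hω)
      exact ⟨r, hq.trans hr, Or.inr ⟨t, ht⟩⟩
  | ex φ =>
    obtain ⟨q, hq, h | h⟩ := hdec p (ex φ) ρ
    · obtain ⟨r, hr, t, ht⟩ := hex q φ ρ h
      exact ⟨r, hq.trans hr, Or.inr ⟨t, ht⟩⟩
    · exact ⟨q, hq, Or.inl h⟩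

/-- The filter generated by an ideal of conditions. -/
def idealFilter (G : Order.Ideal P) (hS : Antitone S) :
    Filter (PointedStructure.{u, v, u', w} L (α ⊕ B)) where
  sets := {A | ∃ p ∈ G, S p ⊆ A}
  univ_sets := G.nonempty.imp fun _ hp => ⟨hp, Set.subset_univ _⟩
  sets_of_superset := fun ⟨p, hp, h⟩ hAB => ⟨p, hp, h.trans hAB⟩
  inter_sets := fun ⟨p, hp, h⟩ ⟨q, hq, h'⟩ =>
    let ⟨r, hr, hpr, hqr⟩ := G.directed p hp q hq
    ⟨r, hr, Set.subset_inter ((hS hpr).trans h) ((hS hqr).trans h')⟩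

theorem mem_idealFilter {G : Order.Ideal P} {hS : Antitone S}
    {A : Set (PointedStructure.{u, v, u', w} L (α ⊕ B))} :
    A ∈ idealFilter G hS ↔ ∃ p ∈ G, S p ⊆ A :=
  Iff.rfl

theorem idealFilter_neBot {G : Order.Ideal P} (hS : Antitone S) (h : ∀ p, (S p).Nonempty) :
    (idealFilter G hS).NeBot := by
  rw [← Filter.empty_mem_iff_bot.not.trans Filter.neBot_iff.symm, mem_idealFilter]
  rintro ⟨p, -, hp⟩
  exact (h p).ne_empty (Set.subset_empty_iff.1 hp)

end Decide

-- Dependence on finitely many names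

section Support

variable (sz : B → ℕ)

/-- Membership in `A` depends only on the values of the variables of `α` and of those in `B` of
size below `k`. -/
def SupportedBelow (k : ℕ) (A : Set (PointedStructure.{u, v, u', w} L (α ⊕ B))) : Prop :=
  ∀ (M : Type w) [L.Structure M] (x y : α ⊕ B → M), (∀ a, x (Sum.inl a) = y (Sum.inl a)) →
    (∀ b, sz b < k → x (Sum.inr b) = y (Sum.inr b)) → (⟨M, x⟩ ∈ A ↔ ⟨M, y⟩ ∈ A)

variable {sz} {k : ℕ} {A A' : Set (PointedStructure.{u, v, u', w} L (α ⊕ B))}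

theorem SupportedBelow.mono (h : SupportedBelow sz k A) {l : ℕ} (hkl : k ≤ l) :
    SupportedBelow sz l A :=
  fun M _ x y hα hB => h M x y hα fun b hb => hB b (hb.trans_le hkl)

theorem SupportedBelow.inter (h : SupportedBelow sz k A) (h' : SupportedBelow sz k A') :
    SupportedBelow sz k (A ∩ A') :=
  fun M _ x y hα hB => and_congr (h M x y hα hB) (h' M x y hα hB)

theorem SupportedBelow.compl (h : SupportedBelow sz k A) : SupportedBelow sz k Aᶜ :=
  fun M _ x y hα hB => not_congr (h M x y hα hB)

/-- A point with the value of one variable changed. -/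
def _root_.PointedStructure.update [DecidableEq B] (ω : PointedStructure.{u, v, u', w} L (α ⊕ B))
    (b : B) (a : ω.carrier) : PointedStructure.{u, v, u', w} L (α ⊕ B) :=
  ⟨ω.carrier, fun c => Sum.casesOn c (fun i => ω.val (Sum.inl i))
    (fun b' => if b' = b then a else ω.val (Sum.inr b'))⟩

/-- A variable of size at least `k` is fresh for `A` and may be reassigned freely. -/
theorem SupportedBelow.update_mem [DecidableEq B] (h : SupportedBelow sz k A)
    {ω : PointedStructure.{u, v, u', w} L (α ⊕ B)} (hω : ω ∈ A) {b : B} (hb : k ≤ sz b)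
    (a : ω.carrier) : ω.update b a ∈ A := by
  refine (h _ ω.val (ω.update b a).val (fun _ => rfl) fun b' hb' => ?_).1 hω
  exact (if_neg (by rintro rfl; omega)).symm

theorem exists_term_bound (t : L.Term (α ⊕ B)) :
    ∃ k, ∀ (M : Type w) [L.Structure M] (x y : α ⊕ B → M),
      (∀ a, x (Sum.inl a) = y (Sum.inl a)) → (∀ b, sz b < k → x (Sum.inr b) = y (Sum.inr b)) →
      t.realize x = t.realize y := by
  induction t with
  | var c =>
    rcases c with a | b
    · exact ⟨0, fun M _ x y hα _ => hα a⟩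
    · exact ⟨sz b + 1, fun M _ x y _ hB => hB b (Nat.lt_succ_self _)⟩
  | func f ts ih =>
    choose k hk using ih
    refine ⟨Finset.univ.sup k, fun M _ x y hα hB => congrArg (Structure.funMap f) (funext fun i =>
      hk i M x y hα fun b hb => hB b (hb.trans_le (Finset.le_sup (Finset.mem_univ i))))⟩

variable (sz k) in
/-- The values of the terms depend only on the values of the variables of `α` and of those in `B`
of size below `k`. -/
def TermsBelow {ι : Type*} (ts : ι → L.Term (α ⊕ B)) : Prop :=
  ∀ (M : Type w) [L.Structure M] (x y : α ⊕ B → M), (∀ a, x (Sum.inl a) = y (Sum.inl a)) →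
    (∀ b, sz b < k → x (Sum.inr b) = y (Sum.inr b)) → ∀ i, (ts i).realize x = (ts i).realize y

theorem TermsBelow.mono {ι : Type*} {ts : ι → L.Term (α ⊕ B)}
    (h : TermsBelow.{u, v, u', w} sz k ts) {l : ℕ} (hkl : k ≤ l) :
    TermsBelow.{u, v, u', w} sz l ts :=
  fun M _ x y hα hB => h M x y hα fun b hb => hB b (hb.trans_le hkl)

theorem exists_termsBelow (sz : B → ℕ) {ι : Type*} [Fintype ι] (ts : ι → L.Term (α ⊕ B)) :
    ∃ k, TermsBelow.{u, v, u', w} sz k ts := by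
  choose k hk using fun i => exists_term_bound (sz := sz) (ts i)
  exact ⟨Finset.univ.sup k, fun M _ x y hα hB i =>
    hk i M x y hα fun b hb => hB b (hb.trans_le (Finset.le_sup (Finset.mem_univ i)))⟩

theorem TermsBelow.snoc {n : ℕ} {ρ : Fin n → L.Term (α ⊕ B)}
    (h : TermsBelow.{u, v, u', w} sz k ρ) {b : B} (hb : sz b < k) :
    TermsBelow.{u, v, u', w} sz k
      (Fin.snoc ρ (Term.var (Sum.inr b)) : Fin (n + 1) → L.Term (α ⊕ B)) := by
  intro M _ x y hα hB i
  refine Fin.lastCases ?_ (fun i => ?_) i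
  · simpa using hB b hb
  · simpa using h M x y hα hB i

theorem TermsBelow.supportedBelow_sat {n : ℕ} {ρ : Fin n → L.Term (α ⊕ B)}
    (h : TermsBelow.{u, v, u', w} sz k ρ) (φ : InfFormula L α n) :
    SupportedBelow sz k (sat φ ρ : Set (PointedStructure.{u, v, u', w} L (α ⊕ B))) := by
  intro M _ x y hα hB
  simp only [sat, Set.mem_ofPred_eq, hα, h M x y hα hB]

theorem TermsBelow.exists_update_mem_sat [DecidableEq B] {n : ℕ} {ρ : Fin n → L.Term (α ⊕ B)}
    (h : TermsBelow.{u, v, u', w} sz k ρ) {b : B} (hb : k ≤ sz b) {φ : InfFormula L α (n + 1)}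
    {ω : PointedStructure.{u, v, u', w} L (α ⊕ B)} (hω : ω ∈ sat (ex φ) ρ) :
    ∃ a, ω.update b a ∈ sat φ (Fin.snoc ρ (Term.var (Sum.inr b)) : Fin (n + 1) → _) := by
  obtain ⟨a, ha⟩ := hω
  refine ⟨a, ?_⟩
  have h₁ : ∀ i, (ρ i).realize ω.val = (ρ i).realize (ω.update b a).val :=
    h _ ω.val (ω.update b a).val (fun _ => rfl) fun b' hb' =>
      (if_neg (by rintro rfl; omega)).symm
  have h₂ : a = (Term.var (Sum.inr b) : L.Term (α ⊕ B)).realize (ω.update b a).val :=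
    (if_pos rfl).symm
  rw [sat, Set.mem_ofPred_eq, realize_term_snoc, ← h₂, ← funext h₁]
  exact ha

end Support

-- Separation by universal formulas

section Separation

/-- The indices of the variables for the larger structure of an extension: the first copy of `ℕ`
names elements of the smaller structure. -/
abbrev ExtIndex : Type := ℕ ⊕ ℕ

/-- The size of an index. -/
abbrev extSize : ExtIndex → ℕ := Sum.elim id id

/-- The variables naming elements of the smaller structure. -/
def namedVars (c : ℕ → B) (k : ℕ) (i : Fin k) : L.Term (α ⊕ B) := Term.var (Sum.inr (c i))

/-- `A` and `C` are separated by a universal formula about the named elements. -/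
def Separable (k : ℕ) (A : Set (PointedStructure.{u, v, u', w} L (α ⊕ ExtIndex)))
    (C : Set (PointedStructure.{u, v, u', w} L (α ⊕ ℕ))) : Prop :=
  ∃ θ : InfFormula L α k, θ.IsUniversal ∧ A ⊆ sat θ (namedVars Sum.inl k) ∧
    C ⊆ (sat θ (namedVars id k))ᶜ

variable {k : ℕ} {A A' : Set (PointedStructure.{u, v, u', w} L (α ⊕ ExtIndex))}
  {C C' : Set (PointedStructure.{u, v, u', w} L (α ⊕ ℕ))}

theorem Separable.mono (h : Separable k A C) (hA : A' ⊆ A) (hC : C' ⊆ C) : Separable k A' C' :=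
  let ⟨θ, hθ, h₁, h₂⟩ := h
  ⟨θ, hθ, hA.trans h₁, hC.trans h₂⟩

/-- The disjunction of the separating formulas separates the union; on the right their conjunction
does. -/
theorem Separable.iUnion_left {A : ℕ → Set (PointedStructure.{u, v, u', w} L (α ⊕ ExtIndex))}
    (h : ∀ i, Separable k (A i) C) : Separable k (⋃ i, A i) C := by
  choose θ hθ hA hC using h
  refine ⟨disj θ, ?_, ?_, ?_⟩
  · simpa [IsUniversal, HasExistential] using hθ
  · exact Set.iUnion_subset fun i ω hω => ⟨i, hA i hω⟩
  · rintro ω hω ⟨i, hi⟩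
    exact hC i hω hi

theorem Separable.iUnion_right {C : ℕ → Set (PointedStructure.{u, v, u', w} L (α ⊕ ℕ))}
    (h : ∀ i, Separable k A (C i)) : Separable k A (⋃ i, C i) := by
  choose θ hθ hA hC using h
  refine ⟨conj θ, ?_, ?_, ?_⟩
  · simpa [IsUniversal, HasExistential] using hθ
  · exact fun ω hω i => hA i hω
  · exact Set.iUnion_subset fun i ω hω h => hC i hω (h i)

theorem Separable.union_left (h : Separable k A C) (h' : Separable k A' C) :
    Separable k (A ∪ A') C :=
  (iUnion_left (A := fun i => if i = 0 then A else A') fun i => by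
    split_ifs <;> assumption).mono
    (Set.union_subset (fun _ h => Set.mem_iUnion.2 ⟨0, h⟩) fun _ h => Set.mem_iUnion.2 ⟨1, h⟩)
    subset_rfl

theorem Separable.union_right (h : Separable k A C) (h' : Separable k A C') :
    Separable k A (C ∪ C') :=
  (iUnion_right (C := fun i => if i = 0 then C else C') fun i => by
    split_ifs <;> assumption).mono subset_rfl
    (Set.union_subset (fun _ h => Set.mem_iUnion.2 ⟨0, h⟩) fun _ h => Set.mem_iUnion.2 ⟨1, h⟩)

theorem realize_namedVars_update {c : ℕ → B} [DecidableEq B] (hc : Function.Injective c)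
    (ω : PointedStructure.{u, v, u', w} L (α ⊕ B)) (a : ω.carrier) :
    (fun i => ((namedVars c (k + 1) i : L.Term (α ⊕ B))).realize (ω.update (c k) a).val) =
      (Fin.snoc (fun i => (namedVars c k i : L.Term (α ⊕ B)).realize ω.val) a :
        Fin (k + 1) → ω.carrier) := by
  ext i
  refine Fin.lastCases ?_ (fun i => ?_) i
  · rw [Fin.snoc_last]
    exact if_pos rfl
  · rw [Fin.snoc_castSucc]
    exact if_neg (fun h => absurd (hc h) (by simpa using i.2.ne))

theorem mem_sat_update {c : ℕ → B} [DecidableEq B] (hc : Function.Injective c)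
    (ω : PointedStructure.{u, v, u', w} L (α ⊕ B)) (a : ω.carrier) (θ : InfFormula L α (k + 1)) :
    ω.update (c k) a ∈ sat θ (namedVars c (k + 1)) ↔
      θ.Realize (fun a => ω.val (Sum.inl a))
        (Fin.snoc (fun i => (namedVars c k i : L.Term (α ⊕ B)).realize ω.val) a) := by
  rw [← realize_namedVars_update hc]
  exact Iff.rfl

/-- A new name may be used for an element of the smaller structure. -/
theorem Separable.of_witness_right (h : Separable (k + 1) A C')
    (hA : SupportedBelow extSize k A) (hC : ∀ ω ∈ C, ∃ a, ω.update k a ∈ C') :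
    Separable k A C := by
  obtain ⟨θ, hθ, h₁, h₂⟩ := h
  -- `A` does not constrain variable `k`, so `θ` holds on `A` for all its values; on `C` the witness
  -- refutes `∀ θ`.
  refine ⟨all θ, hθ, fun ω hω a => ?_, fun ω hω hθ => ?_⟩
  · rw [← mem_sat_update Sum.inl_injective]
    exact h₁ (hA.update_mem hω le_rfl a)
  · obtain ⟨a, ha⟩ := hC ω hω
    exact h₂ ha ((mem_sat_update Function.injective_id ω a θ).2 (hθ a))

/-- A new name may be used for an element of the larger structure. -/
theorem Separable.of_witness_left {l : ℕ} (h : Separable k A' C)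
    (hA : ∀ ω ∈ A, ∃ a, ω.update (Sum.inr l) a ∈ A') : Separable k A C := by
  obtain ⟨θ, hθ, h₁, h₂⟩ := h
  -- The same `θ` works: it speaks only of the first copy of `ℕ`, so changing the value of `Sum.inr
  -- l` does not affect it. No existential quantifier is needed.
  refine ⟨θ, hθ, fun ω hω => ?_, h₂⟩
  obtain ⟨a, ha⟩ := hA ω hω
  exact (h₁ ha : ω.update (Sum.inr l) a ∈ sat θ (namedVars Sum.inl k))

/-- An unused name is quantified away, its present value serving as the witness. -/
theorem Separable.of_succ (h : Separable (k + 1) A C) (hA : SupportedBelow extSize k A)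
    (hC : SupportedBelow id k C) : Separable k A C :=
  h.of_witness_right hA fun ω hω => ⟨ω.val (Sum.inr k), hC.update_mem hω le_rfl _⟩

theorem Separable.of_le {l : ℕ} (h : Separable l A C) (hkl : k ≤ l)
    (hA : SupportedBelow extSize k A) (hC : SupportedBelow id k C) : Separable k A C := by
  induction l, hkl using Nat.le_induction with
  | base => exact h
  | succ l hkl ih => exact ih (h.of_succ (hA.mono hkl) (hC.mono hkl))

end Separation

-- Inseparable pairs as forcing conditions

variable (L α) in
/-- The conditions of the construction: inseparable classes of structures, with names for finitely
many elements. -/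
structure Condition where
  /-- A bound for the names in use. -/
  bound : ℕ
  /-- The requirements on the larger structure. -/
  left : Set (PointedStructure.{u, v, u', w} L (α ⊕ ExtIndex))
  /-- The requirements on the smaller structure. -/
  right : Set (PointedStructure.{u, v, u', w} L (α ⊕ ℕ))
  supported_left : SupportedBelow extSize bound left
  supported_right : SupportedBelow id bound right
  inseparable : ¬ Separable bound left right

namespace Condition

/-- Larger conditions are stronger, so generic sets are ideals. Bounds are bookkeeping and are not
compared. -/
instance : Preorder (Condition.{u, v, u', w} L α) where
  le p q := q.left ⊆ p.left ∧ q.right ⊆ p.right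
  le_refl _ := ⟨subset_rfl, subset_rfl⟩
  le_trans _ _ _ h h' := ⟨h'.1.trans h.1, h'.2.trans h.2⟩

theorem antitone_left : Antitone (left : Condition.{u, v, u', w} L α → _) := fun _ _ h => h.1

theorem antitone_right : Antitone (right : Condition.{u, v, u', w} L α → _) := fun _ _ h => h.2

variable (p : Condition.{u, v, u', w} L α)

theorem not_separable {k : ℕ} (hk : p.bound ≤ k) : ¬ Separable k p.left p.right :=
  fun h => p.inseparable (h.of_le hk p.supported_left p.supported_right)

theorem left_nonempty : p.left.Nonempty := by
  by_contra h
  rw [Set.not_nonempty_iff_eq_empty] at h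
  exact p.inseparable ⟨falsum, id, by simp [h], fun _ _ h => h⟩

theorem right_nonempty : p.right.Nonempty := by
  by_contra h
  rw [Set.not_nonempty_iff_eq_empty] at h
  exact p.inseparable ⟨not falsum, id, fun _ _ h => h, by simp [h]⟩

/-- If every piece `p.left ∩ sat (φ i) ρ` were separable from `p.right`, so would be their union,
which is `p.left`. -/
theorem exists_disj_left {n : ℕ} (φ : ℕ → InfFormula L α n) (ρ : Fin n → L.Term (α ⊕ ExtIndex))
    (h : p.left ⊆ sat (disj φ) ρ) : ∃ q, p ≤ q ∧ ∃ i, q.left ⊆ sat (φ i) ρ := by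
  obtain ⟨k, hk⟩ := exists_termsBelow.{u, v, u', w} extSize ρ
  by_contra! hn
  refine p.not_separable (le_max_left p.bound k) ((Separable.iUnion_left
    (A := fun i => p.left ∩ sat (φ i) ρ) fun i => ?_).mono
      (fun ω hω => Set.mem_iUnion.2 ((h hω).imp fun i hi => ⟨hω, hi⟩)) subset_rfl)
  by_contra hs
  exact hn ⟨max p.bound k, p.left ∩ sat (φ i) ρ, p.right,
    (p.supported_left.mono (le_max_left _ _)).inter
      ((hk.mono (le_max_right _ _)).supportedBelow_sat _),
    p.supported_right.mono (le_max_left _ _), hs⟩ ⟨Set.inter_subset_left, subset_rfl⟩ i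
    Set.inter_subset_right

theorem exists_disj_right {n : ℕ} (φ : ℕ → InfFormula L α n) (ρ : Fin n → L.Term (α ⊕ ℕ))
    (h : p.right ⊆ sat (disj φ) ρ) : ∃ q, p ≤ q ∧ ∃ i, q.right ⊆ sat (φ i) ρ := by
  obtain ⟨k, hk⟩ := exists_termsBelow.{u, v, u', w} id ρ
  by_contra! hn
  refine p.not_separable (le_max_left p.bound k) ((Separable.iUnion_right
    (C := fun i => p.right ∩ sat (φ i) ρ) fun i => ?_).mono subset_rfl
      (fun ω hω => Set.mem_iUnion.2 ((h hω).imp fun i hi => ⟨hω, hi⟩)))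
  by_contra hs
  exact hn ⟨max p.bound k, p.left, p.right ∩ sat (φ i) ρ,
    p.supported_left.mono (le_max_left _ _),
    (p.supported_right.mono (le_max_left _ _)).inter
      ((hk.mono (le_max_right _ _)).supportedBelow_sat _), hs⟩
    ⟨subset_rfl, Set.inter_subset_left⟩ i Set.inter_subset_right

theorem exists_ex_left {n : ℕ} (φ : InfFormula L α (n + 1)) (ρ : Fin n → L.Term (α ⊕ ExtIndex))
    (h : p.left ⊆ sat (ex φ) ρ) :
    ∃ q, p ≤ q ∧ ∃ t, q.left ⊆ sat φ (Fin.snoc ρ t : Fin (n + 1) → _) := by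
  obtain ⟨k, hk⟩ := exists_termsBelow.{u, v, u', w} extSize ρ
  set l := max p.bound k
  have hpl : p.bound ≤ l := le_max_left _ _
  have hkl : k ≤ l := le_max_right _ _
  set t : L.Term (α ⊕ ExtIndex) := Term.var (Sum.inr (Sum.inr l))
  refine ⟨⟨l + 1, p.left ∩ sat φ (Fin.snoc ρ t : Fin (n + 1) → _), p.right,
    (p.supported_left.mono (by omega)).inter
      (((hk.mono (by omega)).snoc (Nat.lt_succ_self l)).supportedBelow_sat _),
    p.supported_right.mono (by omega), fun hs => ?_⟩, ⟨Set.inter_subset_left, subset_rfl⟩, t,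
    Set.inter_subset_right⟩
  refine p.not_separable (k := l + 1) (by omega) (hs.of_witness_left (l := l) fun ω hω => ?_)
  obtain ⟨a, ha⟩ := hk.exists_update_mem_sat (b := Sum.inr l) hkl (h hω)
  exact ⟨a, p.supported_left.update_mem (b := Sum.inr l) hω hpl a, ha⟩

theorem exists_ex_right {n : ℕ} (φ : InfFormula L α (n + 1)) (ρ : Fin n → L.Term (α ⊕ ℕ))
    (h : p.right ⊆ sat (ex φ) ρ) :
    ∃ q, p ≤ q ∧ ∃ t, q.right ⊆ sat φ (Fin.snoc ρ t : Fin (n + 1) → _) := by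
  obtain ⟨k, hk⟩ := exists_termsBelow.{u, v, u', w} id ρ
  set l := max p.bound k
  have hpl : p.bound ≤ l := le_max_left _ _
  have hkl : k ≤ l := le_max_right _ _
  -- The witness takes the first name past the bound; a separating formula then has it as last
  -- variable, where `∀` removes it.
  set t : L.Term (α ⊕ ℕ) := Term.var (Sum.inr l)
  refine ⟨⟨l + 1, p.left, p.right ∩ sat φ (Fin.snoc ρ t : Fin (n + 1) → _),
    p.supported_left.mono (by omega), (p.supported_right.mono (by omega)).inter
      (((hk.mono (by omega)).snoc (Nat.lt_succ_self l)).supportedBelow_sat _), fun hs => ?_⟩,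
    ⟨subset_rfl, Set.inter_subset_left⟩, t, Set.inter_subset_right⟩
  refine p.not_separable hpl (hs.of_witness_right (p.supported_left.mono hpl) fun ω hω => ?_)
  obtain ⟨a, ha⟩ := hk.exists_update_mem_sat (b := l) hkl (h hω)
  exact ⟨a, p.supported_right.update_mem hω hpl a, ha⟩

theorem namedVars_termsBelow {B : Type} {sz : B → ℕ} {c : ℕ → B} (hc : ∀ i, sz (c i) = i) (k : ℕ) :
    TermsBelow.{u, v, u', w} sz k (namedVars c k : Fin k → L.Term (α ⊕ B)) :=
  fun _ _ _ _ _ hB i => hB _ ((hc i).trans_lt i.2)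

/-- Splitting both classes by `σ` gives four pairs. The two on which the sides disagree are
separated by `σ` and by `¬σ`, both universal; were the two agreeing pairs separable as well, `p`
would be. -/
theorem exists_agree_formula {k : ℕ} (hk : p.bound ≤ k) {σ : InfFormula L α k}
    (hE : ¬ σ.HasExistential) (hU : ¬ σ.HasUniversal) :
    ∃ q, p ≤ q ∧ ((q.left ⊆ sat σ (namedVars Sum.inl k) ∧ q.right ⊆ sat σ (namedVars id k)) ∨
      (q.left ⊆ (sat σ (namedVars Sum.inl k))ᶜ ∧ q.right ⊆ (sat σ (namedVars id k))ᶜ)) := by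
  set E : Set (PointedStructure.{u, v, u', w} L (α ⊕ ExtIndex)) := sat σ (namedVars Sum.inl k)
  set F : Set (PointedStructure.{u, v, u', w} L (α ⊕ ℕ)) := sat σ (namedVars id k)
  have hEs : SupportedBelow extSize k E :=
    (namedVars_termsBelow (fun _ => rfl) k).supportedBelow_sat σ
  have hFs : SupportedBelow id k F := (namedVars_termsBelow (fun _ => rfl) k).supportedBelow_sat σ
  have hl := p.supported_left.mono hk
  have hr := p.supported_right.mono hk
  by_contra! hn
  refine p.not_separable hk ?_
  have h₁ : Separable k (p.left ∩ E) (p.right ∩ F) := by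
    by_contra hs
    exact (hn ⟨k, _, _, hl.inter hEs, hr.inter hFs, hs⟩
      ⟨Set.inter_subset_left, Set.inter_subset_left⟩).1 Set.inter_subset_right
      Set.inter_subset_right
  have h₂ : Separable k (p.left ∩ Eᶜ) (p.right ∩ Fᶜ) := by
    by_contra hs
    exact (hn ⟨k, _, _, hl.inter hEs.compl, hr.inter hFs.compl, hs⟩
      ⟨Set.inter_subset_left, Set.inter_subset_left⟩).2 Set.inter_subset_right
      Set.inter_subset_right
  have h₃ : Separable k (p.left ∩ E) (p.right ∩ Fᶜ) :=
    ⟨σ, hE, Set.inter_subset_right, Set.inter_subset_right⟩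
  have h₄ : Separable k (p.left ∩ Eᶜ) (p.right ∩ F) :=
    ⟨not σ, hU, Set.inter_subset_right, fun _ h h' => h' h.2⟩
  exact ((h₁.union_right h₃).union_left (h₄.union_right h₂)).mono
    (fun ω hω => (em (ω ∈ E)).imp (⟨hω, ·⟩) (⟨hω, ·⟩))
    (fun ω hω => (em (ω ∈ F)).imp (⟨hω, ·⟩) (⟨hω, ·⟩))

/-- A term about the smaller structure, read in the larger structure. -/
abbrev _root_.FirstOrder.Language.Term.ext (t : L.Term (α ⊕ ℕ)) : L.Term (α ⊕ ExtIndex) :=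
  t.relabel (Sum.map id Sum.inl)

/-- The two structures can be made to agree on a quantifier-free property of terms. -/
theorem exists_agree {n : ℕ} (Q : ∀ (M : Type w) [L.Structure M], (Fin n → M) → Prop)
    (σ : ∀ k, (Fin n → L.Term (α ⊕ Fin k)) → InfFormula L α k)
    (hE : ∀ k ts, ¬ (σ k ts).HasExistential) (hU : ∀ k ts, ¬ (σ k ts).HasUniversal)
    (hQ : ∀ k ts (M : Type w) [L.Structure M] x y,
      (σ k ts).Realize (M := M) x y ↔ Q M fun i => (ts i).realize (Sum.elim x y))
    (ts : Fin n → L.Term (α ⊕ ℕ)) :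
    ∃ q, p ≤ q ∧
      ((q.left ⊆ {ω | Q _ fun i => (ts i).ext.realize ω.val} ∧
        q.right ⊆ {ω | Q _ fun i => (ts i).realize ω.val}) ∨
      (q.left ⊆ {ω | Q _ fun i => (ts i).ext.realize ω.val}ᶜ ∧
        q.right ⊆ {ω | Q _ fun i => (ts i).realize ω.val}ᶜ)) := by
  obtain ⟨l, hl⟩ := exists_termsBelow.{u, v, u', w} id ts
  set k := max p.bound l
  replace hl := hl.mono ((le_max_right p.bound l).trans (Nat.le_succ k))
  -- Reducing indices modulo `k + 1` is harmless, as the values of the terms depend only on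
  -- variables below `k + 1`; the successor keeps `Fin` inhabited.
  set ts' : Fin n → L.Term (α ⊕ Fin (k + 1)) :=
    fun i => (ts i).relabel (Sum.map id (Fin.ofNat (k + 1)))
  have key : ∀ (M : Type w) [L.Structure M] (x : α → M) (y : ℕ → M) (i : Fin n),
      (ts' i).realize (Sum.elim x fun j : Fin (k + 1) => y j) = (ts i).realize (Sum.elim x y) := by
    intro M _ x y i
    rw [Term.realize_relabel]
    refine hl M (Sum.elim x (fun j : Fin (k + 1) => y j) ∘ Sum.map id (Fin.ofNat (k + 1)))
      (Sum.elim x y) (fun _ => rfl) (fun b hb => congrArg y ?_) i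
    simpa using Nat.mod_eq_of_lt hb
  have h₁ : (sat (σ (k + 1) ts') (namedVars Sum.inl (k + 1)) :
      Set (PointedStructure.{u, v, u', w} L (α ⊕ ExtIndex))) =
      {ω | Q _ fun i => (ts i).ext.realize ω.val} := by
    ext ω
    simp only [sat, Set.mem_ofPred_eq, hQ, Term.realize_relabel]
    refine iff_of_eq (congrArg (Q _) (funext fun i => ?_))
    refine (key _ (fun a => ω.val (Sum.inl a)) (fun j => ω.val (Sum.inr (Sum.inl j))) i).trans ?_
    congr 1
    ext (a | j) <;> rfl
  have h₂ : (sat (σ (k + 1) ts') (namedVars id (k + 1)) :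
      Set (PointedStructure.{u, v, u', w} L (α ⊕ ℕ))) =
      {ω | Q _ fun i => (ts i).realize ω.val} := by
    ext ω
    simp only [sat, Set.mem_ofPred_eq, hQ]
    refine iff_of_eq (congrArg (Q _) (funext fun i => ?_))
    refine (key _ (fun a => ω.val (Sum.inl a)) (fun j => ω.val (Sum.inr j)) i).trans ?_
    congr 1
    ext (a | j) <;> rfl
  rw [← h₁, ← h₂]
  exact p.exists_agree_formula ((le_max_left p.bound l).trans (Nat.le_succ k)) (hE _ _) (hU _ _)

end Condition

-- Interpolation and the theorem

theorem mem_sat_iff_holds {B : Type} (φ : InfFormula L α 0) (ρ : Fin 0 → L.Term (α ⊕ B))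
    (ω : PointedStructure.{u, v, u', w} L (α ⊕ B)) :
    ω ∈ sat φ ρ ↔ φ.Holds fun a => ω.val (Sum.inl a) :=
  iff_of_eq (congrArg (Realize _ φ) (Subsingleton.elim _ _))

/-- If no universal formula lies between `φ` and `ψ`, some structure satisfies `φ` at elements of
a substructure that does not satisfy `ψ` there. -/
theorem exists_embedding_of_not_interpolated [Countable (Σ n, L.Functions n)]
    [Countable (Σ n, L.Relations n)] [Countable α] (φ ψ : InfFormula L α 0)
    (h : ¬ ∃ θ : InfFormula L α 0, θ.IsUniversal ∧
      ∀ (M : Type w) [L.Structure M] [Nonempty M] (x : α → M),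
        (φ.Holds x → θ.Holds x) ∧ (θ.Holds x → ψ.Holds x)) :
    ∃ (M N : Type max u u') (_ : L.Structure M) (_ : L.Structure N) (_ : Countable M)
      (_ : Nonempty N) (f : N ↪[L] M) (x : α → N), φ.Holds (f ∘ x) ∧ ¬ ψ.Holds x := by
  -- With no names in use, a separating formula is exactly an interpolant; the names may take
  -- arbitrary values.
  let p₀ : Condition.{u, v, u', w} L α :=
    ⟨0, sat φ Fin.elim0, (sat ψ Fin.elim0)ᶜ,
      TermsBelow.supportedBelow_sat (fun _ _ _ _ _ _ i => i.elim0) φ,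
      (TermsBelow.supportedBelow_sat (fun _ _ _ _ _ _ i => i.elim0) ψ).compl, by
        rintro ⟨θ, hθ, h₁, h₂⟩
        refine h ⟨θ, hθ, fun M _ hM x => ⟨fun hx => ?_, fun hx => ?_⟩⟩
        · exact (mem_sat_iff_holds θ _ ⟨M, Sum.elim x fun _ => hM.some⟩).1
            (h₁ ((mem_sat_iff_holds φ _ ⟨M, Sum.elim x fun _ => hM.some⟩).2 hx))
        · by_contra hn
          exact h₂ (mt (mem_sat_iff_holds ψ _ ⟨M, Sum.elim x fun _ => hM.some⟩).1 hn)
            ((mem_sat_iff_holds θ _ ⟨M, Sum.elim x fun _ => hM.some⟩).2 hx)⟩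
  have := φ.countable_subformulas.to_subtype
  have := ψ.countable_subformulas.to_subtype
  -- The countably many requirements: decide the subformulas of `φ` on the left and of `ψ` on the
  -- right, and agree on equations and on relations between terms of `N`.
  let ι := (Σ χ : φ.subformulas, Fin χ.1.1 → L.Term (α ⊕ ExtIndex)) ⊕
    (Σ χ : ψ.subformulas, Fin χ.1.1 → L.Term (α ⊕ ℕ)) ⊕ (Fin 2 → L.Term (α ⊕ ℕ)) ⊕
    (Σ R : (Σ n, L.Relations n), Fin R.1 → L.Term (α ⊕ ℕ))
  let : Encodable ι := Encodable.ofCountable ι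
  let eqv : ∀ (M : Type w) [L.Structure M], (Fin 2 → M) → Prop := fun _ _ a => a 0 = a 1
  let agree := fun (n : ℕ) (Q : ∀ (M : Type w) [L.Structure M], (Fin n → M) → Prop)
      (ts : Fin n → L.Term (α ⊕ ℕ)) (q : Condition.{u, v, u', w} L α) =>
    (q.left ⊆ {ω | Q _ fun i => (ts i).ext.realize ω.val} ∧
        q.right ⊆ {ω | Q _ fun i => (ts i).realize ω.val}) ∨
      (q.left ⊆ {ω | Q _ fun i => (ts i).ext.realize ω.val}ᶜ ∧
        q.right ⊆ {ω | Q _ fun i => (ts i).realize ω.val}ᶜ)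
  let 𝒟 : ι → Order.Cofinal (Condition.{u, v, u', w} L α) := Sum.elim
    (fun i => ⟨{q | Decides q.left i.1.1.2 i.2}, fun p =>
      let ⟨q, hq, h⟩ := exists_decides Condition.exists_disj_left Condition.exists_ex_left
        p i.1.1.2 i.2
      ⟨q, h, hq⟩⟩) <| Sum.elim
    (fun i => ⟨{q | Decides q.right i.1.1.2 i.2}, fun p =>
      let ⟨q, hq, h⟩ := exists_decides Condition.exists_disj_right Condition.exists_ex_right
        p i.1.1.2 i.2
      ⟨q, h, hq⟩⟩) <| Sum.elim
    (fun ts => ⟨{q | agree 2 eqv ts q}, fun p =>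
      let ⟨q, hq, h⟩ := p.exists_agree eqv (fun k ts => equal (ts 0) (ts 1)) (fun _ _ => id)
        (fun _ _ => id) (fun _ _ _ _ _ _ => Iff.rfl) ts
      ⟨q, h, hq⟩⟩)
    (fun i => ⟨{q | agree i.1.1 (fun _ _ => Structure.RelMap i.1.2) i.2 q}, fun p =>
      let ⟨q, hq, h⟩ := p.exists_agree (fun _ _ => Structure.RelMap i.1.2)
        (fun k ts => rel i.1.2 ts) (fun _ _ => id) (fun _ _ => id)
        (fun _ _ _ _ _ _ => Iff.rfl) i.2
      ⟨q, h, hq⟩⟩)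
  let G := Order.idealOfCofinals p₀ 𝒟
  have hG : ∀ i, ∃ q ∈ G, q ∈ 𝒟 i := fun i =>
    let ⟨q, hq, hqG⟩ := Order.cofinal_meets_idealOfCofinals p₀ 𝒟 i
    ⟨q, hqG, hq⟩
  let HM := idealFilter G Condition.antitone_left
  let HN := idealFilter G Condition.antitone_right
  have : HM.NeBot := idealFilter_neBot _ Condition.left_nonempty
  have : HN.NeBot := idealFilter_neBot _ Condition.right_nonempty
  have hagree : ∀ (n : ℕ) (Q : ∀ (M : Type w) [L.Structure M], (Fin n → M) → Prop)
      (ts : Fin n → L.Term (α ⊕ ℕ)), (∃ q ∈ G, agree n Q ts q) →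
      ((∀ᶠ ω in HM, Q _ fun i => (ts i).ext.realize ω.val) ↔
        ∀ᶠ ω in HN, Q _ fun i => (ts i).realize ω.val) := by
    rintro n Q ts ⟨q, hq, ⟨h₁, h₂⟩ | ⟨h₁, h₂⟩⟩
    · exact iff_of_true ⟨q, hq, h₁⟩ ⟨q, hq, h₂⟩
    · refine iff_of_false (fun h => ?_) fun h => ?_
      · exact Filter.empty_notMem HM (by simpa using Filter.inter_mem h ⟨q, hq, h₁⟩)
      · exact Filter.empty_notMem HN (by simpa using Filter.inter_mem h ⟨q, hq, h₂⟩)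
  have heq : ∀ s t : L.Term (α ⊕ ℕ), (∀ᶠ ω in HM, s.ext.realize ω.val = t.ext.realize ω.val) ↔
      ∀ᶠ ω in HN, s.realize ω.val = t.realize ω.val := fun s t =>
    hagree 2 eqv ![s, t] (hG (Sum.inr (Sum.inr (Sum.inl ![s, t]))))
  have hrel : ∀ {n : ℕ} (R : L.Relations n) (ts : Fin n → L.Term (α ⊕ ℕ)),
      (∀ᶠ ω in HM, Structure.RelMap R fun i => (ts i).ext.realize ω.val) ↔
      ∀ᶠ ω in HN, Structure.RelMap R fun i => (ts i).realize ω.val := fun R ts =>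
    hagree _ (fun _ _ => Structure.RelMap R) ts (hG (Sum.inr (Sum.inr (Sum.inr ⟨⟨_, R⟩, ts⟩))))
  -- Agreement on equations makes `f` both well defined and injective; functions are respected
  -- because `Term.ext` commutes with forming terms.
  let f : Quotient HN.termSetoid ↪[L] Quotient HM.termSetoid :=
    { toFun := Quotient.map Term.ext fun s t h => (heq s t).2 h
      inj' := by
        rintro ⟨s⟩ ⟨t⟩ h
        exact Quotient.sound ((heq s t).1 (Quotient.exact h))
      map_fun' := by
        intro n g x
        obtain ⟨ts, rfl⟩ : ∃ ts : Fin n → L.Term (α ⊕ ℕ),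
            x = fun i => Quotient.mk HN.termSetoid (ts i) :=
          ⟨fun i => (x i).out, funext fun i => (Quotient.out_eq _).symm⟩
        rw [funMap_quotient_mk']
        exact (funMap_quotient_mk' HM.termSetoid g fun i => (ts i).ext).symm
      map_rel' := by
        intro n R x
        obtain ⟨ts, rfl⟩ : ∃ ts : Fin n → L.Term (α ⊕ ℕ),
            x = fun i => Quotient.mk HN.termSetoid (ts i) :=
          ⟨fun i => (x i).out, funext fun i => (Quotient.out_eq _).symm⟩
        rw [relMap_quotient_mk' HN.termSetoid]
        exact (relMap_quotient_mk' HM.termSetoid R fun i => (ts i).ext).trans (hrel R ts) }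
  refine ⟨Quotient HM.termSetoid, Quotient HN.termSetoid, inferInstance, inferInstance,
    inferInstance, ⟨Quotient.mk _ (Term.var (Sum.inr 0))⟩, f,
    fun a => Quotient.mk _ (Term.var (Sum.inl a)), ?_, ?_⟩
  · have := (realize_termModel HM φ (fun χ hχ ρ =>
      let ⟨q, hq, hd⟩ := hG (Sum.inl ⟨⟨χ, hχ⟩, ρ⟩)
      ⟨q.left, ⟨q, hq, subset_rfl⟩, hd⟩) Fin.elim0).2
      ⟨p₀, Order.mem_idealOfCofinals p₀ 𝒟, subset_rfl⟩
    exact (iff_of_eq (congrArg (Realize _ φ) (Subsingleton.elim _ _))).1 this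
  · intro hψ
    have := (realize_termModel HN ψ (fun χ hχ ρ =>
      let ⟨q, hq, hd⟩ := hG (Sum.inr (Sum.inl ⟨⟨χ, hχ⟩, ρ⟩))
      ⟨q.right, ⟨q, hq, subset_rfl⟩, hd⟩) Fin.elim0).1
      ((iff_of_eq (congrArg (Realize _ ψ) (Subsingleton.elim _ _))).1 hψ)
    have h' : (sat ψ Fin.elim0)ᶜ ∈ HN := ⟨p₀, Order.mem_idealOfCofinals p₀ 𝒟, subset_rfl⟩
    exact Filter.empty_notMem HN (by simpa using Filter.inter_mem this h')

/-- A formula preserved by submodels is equivalent to a universal formula. -/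
theorem PreservedBySubmodels.exists_isUniversal {φ : InfFormula L α 0}
    (hφ : PreservedBySubmodels.{u, v, u', w} φ) :
    ∃ θ : InfFormula L α 0, θ.IsUniversal ∧ LogicallyEquivalent.{u, v, u', w} φ θ := by
  obtain ⟨F, R, A, hF, hR, hA, h⟩ := exists_sublanguage φ
  obtain ⟨φ', rfl⟩ := h F R A subset_rfl subset_rfl subset_rfl
  have := hF.to_subtype
  have := hR.to_subtype
  have := hA.to_subtype
  by_cases hθ : ∃ θ : InfFormula (sublanguage F R) A 0, θ.IsUniversal ∧
      ∀ (M : Type w) [(sublanguage F R).Structure M] [Nonempty M] (x : A → M),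
        (φ'.Holds x → θ.Holds x) ∧ (θ.Holds x → φ'.Holds x)
  · obtain ⟨θ, hθ, hφθ⟩ := hθ
    refine ⟨θ.map (sublanguageHom F R) Subtype.val, hθ.map _ _, fun M _ _ x => ?_⟩
    let := (sublanguageHom F R).reduct M
    rw [holds_map, holds_map]
    exact ⟨(hφθ M _).1, (hφθ M _).2⟩
  · obtain ⟨M, N, _, _, _, _, f, x, h₁, h₂⟩ := exists_embedding_of_not_interpolated φ' φ' hθ
    obtain ⟨_, _, _, _, f', hf⟩ :=
      exists_expansion_embedding (sublanguageHom_injective F R) f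
    classical
    -- The variables outside `A` do not occur in the formula and get an arbitrary value.
    obtain ⟨x', rfl⟩ : ∃ x' : α → N, x = x' ∘ Subtype.val :=
      ⟨fun a => if h : a ∈ A then x ⟨a, h⟩ else Classical.arbitrary N, by ext a; simp⟩
    refine absurd ((holds_map (sublanguageHom F R) Subtype.val x' φ').1
      (hφ.holds_of_embedding f' x' ?_)) h₂
    rw [holds_map, hf]
    exact h₁

end InfFormula

end Malitz

theorem mainTheorem9 {L : FirstOrder.Language.{u, v}} {α : Type u'} (φ : InfFormula L α 0) :
    InfFormula.PreservedBySubmodels.{u, v, u', w} φ ↔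
      ∃ θ : InfFormula L α 0,
        θ.IsUniversal ∧ InfFormula.LogicallyEquivalent.{u, v, u', w} φ θ :=
  ⟨fun h => h.exists_isUniversal, fun ⟨_, hθ, h⟩ =>
    hθ.preservedBySubmodels.congr fun M _ _ x => (h M x).symm⟩
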